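/- Let $n\ge 1$ and $N \ge 2$ be integers. Let $\mathcal{B}_N((\mathbb{Z}^n)^N)$ be the set of all nonnegative functions $V$ on $(\mathbb{Z}^n)^N$ for which there is a constant $c\in(0,\infty)$ such that $$\sum_{\nu_1,\dots,\nu_N\in\mathbb{Z}^n} V(\nu_1,\dots,\nu_N)\,A_0(\nu_1+\dots+\nu_N)\prod_{j=1}^N A_j(\nu_j)\le c\prod_{j=0}^N\|A_j\|_{\ell^2(\mathbb{Z}^n)}$$ for all nonnegative functions $A_0,A_1,\dots,A_N$ on $\mathbb{Z}^n$. For $0<q<\infty$, a function $a$ on a countable set $K$ belongs to $\ell^{q,\infty}(K)$ if $\sup_{t>0} t\,\bigl(\#\{k\in K: |a(k)|>t\}\bigr)^{1/q}<\infty$. Then every nonnegative function in $\ell^{\frac{2N}{N-1},\infty}((\mathbb{Z}^n)^N)$ belongs to $\mathcal{B}_N((\mathbb{Z}^n)^N)$. In particular, the function $$V(\nu_1,\dots,\nu_N)=(1+|\nu_1|+\dots+|\nu_N|)^{-(N-1)n/2},\qquad \nu_1,\dots,\nu_N\in\mathbb{Z}^n,$$ where $|\cdot|$ is the Euclidean norm,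 belongs to $\mathcal{B}_N((\mathbb{Z}^n)^N)$. -/

import Mathlib

open scoped NNReal ENNReal

/-- The quasi-norm of the weak sequence space `ℓ^{q,∞}(K)`, with values in `[0, ∞]`:
`sup_{t > 0} t * #{k : |a k| > t} ^ (1/q)`. -/
noncomputable def weakEllNorm {K E : Type*} [NormedAddCommGroup E] (q : ℝ) (a : K → E) : ℝ≥0∞ :=
  ⨆ (t : ℝ≥0) (_ : 0 < t), (t : ℝ≥0∞) * (({k : K | (t : ℝ) < ‖a k‖}.encard : ℕ∞) : ℝ≥0∞) ^ (1 / q)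

/-- Membership in the weak sequence space `ℓ^{q,∞}(K)`, `0 < q < ∞`. -/
def MemWeakEll {K E : Type*} [NormedAddCommGroup E] (q : ℝ) (a : K → E) : Prop :=
  weakEllNorm q a < ∞

/-- The `ℓ²` norm of a nonnegative function, with values in `[0, ∞]`. -/
noncomputable def ellTwoNorm {K : Type*} (A : K → ℝ≥0) : ℝ≥0∞ :=
  (∑' k, (A k : ℝ≥0∞) ^ 2) ^ (1 / 2 : ℝ)

/-- The class `𝓑_N((ℤⁿ)ᴺ)`. Sums and norms are taken in `[0, ∞]`; a point `ν` of `(ℤⁿ)ᴺ` is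
`ν : Fin N → Fin n → ℤ`, and the family `A_0, A_1, …, A_N` is indexed by `Fin (N + 1)`. -/
def classB (n N : ℕ) : Set ((Fin N → Fin n → ℤ) → ℝ) :=
  {V | (∀ ν, 0 ≤ V ν) ∧ ∃ c : ℝ≥0, 0 < c ∧ ∀ A : Fin (N + 1) → (Fin n → ℤ) → ℝ≥0,
    ∑' ν : Fin N → Fin n → ℤ,
        ENNReal.ofReal (V ν) * (A 0 (∑ j, ν j) : ℝ≥0∞) * ∏ j : Fin N, (A j.succ (ν j) : ℝ≥0∞)
      ≤ (c : ℝ≥0∞) * ∏ j : Fin (N + 1), ellTwoNorm (A j)}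

/-- The Euclidean length `|μ|` of a lattice point `μ ∈ ℤⁿ`. -/
noncomputable def latticeNorm {n : ℕ} (μ : Fin n → ℤ) : ℝ :=
  Real.sqrt (∑ i, (μ i : ℝ) ^ 2)

/-! With `q = 2N/(N-1)`, weak type gives `∑_{x ∈ s} V x ≤ C * #s ^ α`, where `α = 1 - 1/q =
(N+1)/(2N)` (`sum_le_of_level_card_le`). Normalise the `A j` in ℓ² and split the form into blocks on
which each `A j` is of size `2 ^ k j`, attained on a finite set `E j`. Any `N` of `ν_1, …, ν_N, ∑
ν_j` determine the rest, so the index `i` with the smallest `k i = u` may be dropped: a block has at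
most `∏_{j ≠ i} #E j` points. Let `w j ≥ 2 ^ (2 * k j) * #E j` be the ℓ² mass of `A j` at its level.
As `2α = 1 + 1/N`, the block contributes at most a constant times `∏_{j ≠ i} 2 ^ (-(k j - u)/N) * w
j ^ α` (`sum_block_le`). The `w` factors are at most `∑ w j`, which is summable over `u`; the
excesses `k j - u` give geometric series (`tsum_form_le`). -/

/-! ### Sums of a weak-type function over finite sets -/

/-- Bernoulli's inequality for the concave power `1 - p`; it is the induction increment in the next
estimate. -/
theorem rpow_one_sub_le {k p : ℝ} (hp0 : 0 < p) (hp1 : p < 1) (hk0 : 0 ≤ k) :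
    k ^ (1 - p) ≤ (k + 1) ^ (1 - p) - (1 - p) * (k + 1) ^ (-p) := by
    have h1 := rpow_one_add_le_one_add_mul_self (s := -1 / (k + 1)) (p := 1 - p)
      (by rw [le_div_iff₀ (by positivity)]; linarith) (by linarith) (by linarith)
    have h2 : k = (k + 1) * (1 + -1 / (k + 1)) := by field_simp; ring
    have h3 : (0 : ℝ) ≤ 1 + -1 / (k + 1) := by
      have : 1 + -1 / (k + 1) = k / (k + 1) := by field_simp; ring
      rw [this]; positivity
    have h4 : (k + 1) ^ (1 - p) = (k + 1) ^ (-p) * (k + 1) := by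
      rw [show 1 - p = -p + 1 by ring, Real.rpow_add (by positivity), Real.rpow_one]
    calc k ^ (1 - p) = (k + 1) ^ (1 - p) * (1 + -1 / (k + 1)) ^ (1 - p) := by
          conv_lhs => rw [h2]
          rw [Real.mul_rpow (by positivity) h3]
      _ ≤ (k + 1) ^ (1 - p) * (1 + (1 - p) * (-1 / (k + 1))) := by gcongr
      _ = _ := by rw [h4]; field_simp; ring

/-- A decreasing-rearrangement estimate: if at most `(M / t) ^ (1 / p)` values of `V` exceed `t`, for
every `t > 0`, then the sum of `V` over `s` is at most a constant times `#s ^ (1 - p)`. -/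
theorem sum_le_of_level_card_le {X : Type*} {V : X → ℝ} {M p : ℝ} (hp0 : 0 < p)
    (hp1 : p < 1) (hM : 0 ≤ M)
    (h : ∀ t : ℝ, 0 < t → ∀ s : Finset X, (∀ x ∈ s, t < V x) → t * (s.card : ℝ) ^ p ≤ M)
    (s : Finset X) : ∑ x ∈ s, V x ≤ M / (1 - p) * (s.card : ℝ) ^ (1 - p) := by
  classical
  induction s using Finset.induction_on_min_value V with
  | empty => simp [Real.zero_rpow (by linarith : 1 - p ≠ 0)]
  | insert a s has hmin ih =>
    rw [Finset.sum_insert has, Finset.card_insert_of_notMem has]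
    push_cast
    have hk0 : (0 : ℝ) ≤ s.card := by positivity
    have hpos : 0 < ((s.card : ℝ) + 1) ^ p := by positivity
    -- `a` minimises `V` on `insert a s`, so every `t < V a` is exceeded on all `#s + 1` points; let
    -- `t` tend to `V a`.
    have hVa : V a * ((s.card : ℝ) + 1) ^ p ≤ M := by
      by_cases ha : V a ≤ 0
      · exact (mul_nonpos_of_nonpos_of_nonneg ha hpos.le).trans hM
      push Not at ha
      rw [← le_div_iff₀ hpos]
      refine le_of_forall_lt_imp_le_of_dense fun t ht => ?_
      by_cases ht0 : t ≤ 0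
      · exact ht0.trans (by positivity)
      push Not at ht0
      rw [le_div_iff₀ hpos]
      have := h t ht0 (insert a s) (by
        intro x hx
        rcases Finset.mem_insert.1 hx with rfl | hx
        · exact ht
        · exact ht.trans_le (hmin x hx))
      rw [Finset.card_insert_of_notMem has] at this
      push_cast at this
      exact this
    generalize (s.card : ℝ) = k at ih hk0 hpos hVa ⊢
    have hVa' : V a ≤ M * (k + 1) ^ (-p) := by
      rw [Real.rpow_neg (by positivity), ← div_eq_mul_inv, le_div_iff₀ hpos]
      exact hVa
    have hber := rpow_one_sub_le hp0 hp1 hk0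
    have h5 : 0 < 1 - p := by linarith
    calc V a + ∑ x ∈ s, V x
        ≤ M * (k + 1) ^ (-p) + M / (1 - p) * ((k + 1) ^ (1 - p) - (1 - p) * (k + 1) ^ (-p)) := by
          refine add_le_add hVa' (ih.trans ?_)
          gcongr
      _ = _ := by field_simp; ring

/-- If a point is determined by any all-but-one of its projections `π j x`, then the number of points
with all projections in prescribed finite sets is bounded by the product of all but one of their
cardinalities. -/
theorem card_le_prod_erase {ι X Y : Type*} [Fintype ι] [DecidableEq ι] {π : ι → X → Y} {i : ι}
    (hπ : ∀ x x', (∀ j, j ≠ i → π j x = π j x') → x = x') (E : ι → Finset Y) (s : Finset X)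
    (hs : ∀ x ∈ s, ∀ j, π j x ∈ E j) :
    s.card ≤ ∏ j ∈ Finset.univ.erase i, (E j).card := by
  have h := Finset.card_le_card_of_injOn (s := s)
    (t := Fintype.piFinset fun j : {j // j ≠ i} => E j) (fun x j => π j x)
    (fun x hx => by simpa using fun j _ => hs x hx j)
    (fun x _ x' _ hxx => hπ x x' fun j hj => congrFun hxx ⟨j, hj⟩)
  rw [Fintype.card_piFinset] at h
  rwa [Finset.prod_subtype (Finset.univ.erase i) (p := fun j => j ≠ i) (by simp)]

theorem ENNReal.tsum_prod_geometric_le {ι : Type*} [Fintype ι] (θ : ℝ≥0∞) :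
    ∑' m : ι → ℕ, ∏ j, θ ^ m j ≤ ((1 - θ)⁻¹) ^ Fintype.card ι := by
  classical
  rw [ENNReal.tsum_eq_iSup_sum]
  refine iSup_le fun s => ?_
  obtain ⟨K, hK⟩ : ∃ K, ∀ m ∈ s, ∀ j, m j < K := by
    refine ⟨(s.sup fun m => Finset.univ.sup m) + 1, fun m hm j => Nat.lt_succ_of_le ?_⟩
    exact (Finset.le_sup (f := m) (Finset.mem_univ j)).trans
      (Finset.le_sup (f := fun m : ι → ℕ => Finset.univ.sup m) hm)
  calc ∑ m ∈ s, ∏ j, θ ^ m j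
      ≤ ∑ m ∈ Fintype.piFinset fun _ : ι => Finset.range K, ∏ j, θ ^ m j :=
        Finset.sum_le_sum_of_subset fun m hm => by simpa using hK m hm
    _ = ∏ _j : ι, ∑ k ∈ Finset.range K, θ ^ k :=
        (Finset.prod_univ_sum (fun _ => Finset.range K) (fun _ k => θ ^ k)).symm
    _ ≤ ∏ _j : ι, (1 - θ)⁻¹ := by
        gcongr with j
        rw [← ENNReal.tsum_geometric]
        exact ENNReal.sum_le_tsum _
    _ = _ := by simp

/-! ### Dyadic levels and their ℓ² mass -/

theorem two_rpow_log_le {a : ℝ≥0} (ha : a ≠ 0) :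
    (2 : ℝ≥0∞) ^ ((Int.log 2 a : ℤ) : ℝ) ≤ a := by
  have h := Int.zpow_log_le_self (b := 2) (R := ℝ≥0) (by norm_num) (pos_iff_ne_zero.2 ha)
  rw [ENNReal.rpow_intCast]
  have := ENNReal.coe_le_coe.2 h
  rwa [ENNReal.coe_zpow (by norm_num)] at this

theorem le_two_rpow_log_add_one (a : ℝ≥0) :
    (a : ℝ≥0∞) ≤ 2 * (2 : ℝ≥0∞) ^ ((Int.log 2 a : ℤ) : ℝ) := by
  have h := (Int.lt_zpow_succ_log_self (b := 2) (R := ℝ≥0) (by norm_num) a).le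
  have := ENNReal.coe_le_coe.2 h
  rw [ENNReal.coe_zpow (by norm_num)] at this
  rw [ENNReal.rpow_intCast]
  refine this.trans_eq ?_
  rw [ENNReal.zpow_add (by norm_num) (by norm_num), zpow_one, mul_comm]
  norm_num

/-- The part of `∑ A ^ 2` carried by the points where `A` is of size `2 ^ k`. -/
noncomputable def levelMass {Y : Type*} (A : Y → ℝ≥0) (k : ℤ) : ℝ≥0∞ :=
  ∑' y : (fun y => Int.log 2 (A y)) ⁻¹' {k}, (A y : ℝ≥0∞) ^ 2

/-- Zeros of `A` fall into level `0`, since `Int.log 2 0 = 0`, but carry no mass. -/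
theorem tsum_levelMass {Y : Type*} (A : Y → ℝ≥0) :
    ∑' k, levelMass A k = ∑' y, (A y : ℝ≥0∞) ^ 2 :=
  ENNReal.tsum_fiberwise (fun y => (A y : ℝ≥0∞) ^ 2) _

theorem card_le_levelMass {Y : Type*} (A : Y → ℝ≥0) (k : ℤ) (E : Finset Y)
    (hE : ∀ y ∈ E, A y ≠ 0 ∧ Int.log 2 (A y) = k) :
    ((2 : ℝ≥0∞) ^ (k : ℝ)) ^ 2 * E.card ≤ levelMass A k := by
  calc ((2 : ℝ≥0∞) ^ (k : ℝ)) ^ 2 * E.card = ∑ _y ∈ E, ((2 : ℝ≥0∞) ^ (k : ℝ)) ^ 2 := by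
        rw [Finset.sum_const, nsmul_eq_mul, mul_comm]
    _ ≤ ∑ y ∈ E, (A y : ℝ≥0∞) ^ 2 := by
        refine Finset.sum_le_sum fun y hy => ?_
        obtain ⟨h0, rfl⟩ := hE y hy
        gcongr
        exact two_rpow_log_le h0
    _ = ∑' y : (E : Set Y), (A y : ℝ≥0∞) ^ 2 :=
        (Finset.tsum_subtype' E fun y => (A y : ℝ≥0∞) ^ 2).symm
    _ ≤ _ := ENNReal.tsum_mono_subtype (fun y => (A y : ℝ≥0∞) ^ 2) fun y hy => (hE y hy).2

theorem finite_log_eq {Y : Type*} {A : Y → ℝ≥0} (hA : ∑' y, (A y : ℝ≥0∞) ^ 2 ≠ ∞) (k : ℤ) :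
    {y | A y ≠ 0 ∧ Int.log 2 (A y) = k}.Finite := by
  refine (ENNReal.finite_const_le_of_tsum_ne_top hA (ε := ((2 : ℝ≥0∞) ^ (k : ℝ)) ^ 2)
    (pow_ne_zero _ (ENNReal.rpow_pos (by norm_num) (by norm_num)).ne')).subset ?_
  rintro y ⟨h0, rfl⟩
  simp only [Set.mem_ofPred_eq]
  gcongr
  exact two_rpow_log_le h0

/-- Raising `h` to the power `α` produces `2 ^ ((u + m)(1 + 1/N))`; the factor `2 ^ (u/N)`, a share
of the dropped smallest value, cancels all but `2 ^ (m/N)`. -/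
theorem two_rpow_mul_rpow_le {N : ℕ} (hN : 1 ≤ N) (u : ℤ) (m : ℕ) {c w : ℝ≥0∞}
    (h : ((2 : ℝ≥0∞) ^ ((u + m : ℤ) : ℝ)) ^ 2 * c ≤ w) :
    (2 : ℝ≥0∞) ^ ((u : ℝ) / N) * (2 : ℝ≥0∞) ^ ((u + m : ℤ) : ℝ) * c ^ (((N : ℝ) + 1) / (2 * N)) ≤
      ((2 : ℝ≥0∞) ^ (-1 / (N : ℝ))) ^ m * w ^ (((N : ℝ) + 1) / (2 * N)) := by
  have hN0 : (N : ℝ) ≠ 0 := by positivity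
  have hα : 0 ≤ ((N : ℝ) + 1) / (2 * N) := by positivity
  refine le_trans (le_of_eq ?_) (mul_le_mul_right (ENNReal.rpow_le_rpow h hα) _)
  rw [ENNReal.mul_rpow_of_nonneg _ _ hα, ← mul_assoc]
  congr 1
  simp only [← ENNReal.rpow_natCast, ← ENNReal.rpow_mul]
  rw [← ENNReal.rpow_add _ _ (by norm_num) (by norm_num),
    ← ENNReal.rpow_add _ _ (by norm_num) (by norm_num)]
  congr 1
  push_cast
  field_simp
  ring

/-- The total exponent `N * α = (N+1)/2` is at least `1`, so for masses at most `1` the product is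
bounded by the largest mass. -/
theorem prod_rpow_le_sum {ι : Type*} [Fintype ι] [DecidableEq ι] {N : ℕ} (hN : 1 ≤ N)
    {i : ι} (hι : (Finset.univ.erase i).card = N) {w : ι → ℝ≥0∞} (hw : ∀ j, w j ≤ 1) :
    ∏ j ∈ Finset.univ.erase i, w j ^ (((N : ℝ) + 1) / (2 * N)) ≤ ∑ j, w j := by
  have hN0 : (N : ℝ) ≠ 0 := by positivity
  have hN1 : (1 : ℝ) ≤ N := by exact_mod_cast hN
  obtain ⟨a, -, ha⟩ := Finset.exists_max_image Finset.univ w ⟨i, Finset.mem_univ i⟩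
  calc ∏ j ∈ Finset.univ.erase i, w j ^ (((N : ℝ) + 1) / (2 * N))
      ≤ ∏ _j ∈ Finset.univ.erase i, w a ^ (((N : ℝ) + 1) / (2 * N)) := by
        gcongr with j
        exact ha j (Finset.mem_univ j)
    _ = w a ^ (((N : ℝ) + 1) / 2) := by
        rw [Finset.prod_const, hι, ← ENNReal.rpow_natCast, ← ENNReal.rpow_mul]
        congr 1
        field_simp
    _ ≤ w a ^ (1 : ℝ) := ENNReal.rpow_le_rpow_of_exponent_ge (hw a) (by linarith)
    _ = w a := ENNReal.rpow_one _
    _ ≤ _ := Finset.single_le_sum (f := w) (fun _ _ => zero_le) (Finset.mem_univ a)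

/-! ### The multilinear form for normalised families -/

section Form

variable {ι X Y : Type*} [Fintype ι] [DecidableEq ι] {N : ℕ} {π : ι → X → Y}
  {W : X → ℝ≥0∞} {C : ℝ≥0∞}

/-- The estimate of the form on a block where each `A j` has size `2 ^ (u + m j)`, with
`min m = 0`. -/
theorem sum_block_le (hN : 1 ≤ N) (hι : Fintype.card ι = N + 1)
    (hπ : ∀ i x x', (∀ j, j ≠ i → π j x = π j x') → x = x')
    (hW : ∀ s : Finset X, ∑ x ∈ s, W x ≤ C * (s.card : ℝ≥0∞) ^ (((N : ℝ) + 1) / (2 * N)))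
    {A : ι → Y → ℝ≥0} (hA : ∀ j, ∑' y, (A j y : ℝ≥0∞) ^ 2 ≤ 1) (u : ℤ) (m : ι → ℕ)
    {i : ι} (hi : m i = 0) (s : Finset X)
    (hs : ∀ x ∈ s, ∀ j, A j (π j x) ≠ 0 ∧ Int.log 2 (A j (π j x)) = u + m j) :
    ∑ x ∈ s, W x * ∏ j, (A j (π j x) : ℝ≥0∞) ≤
      C * 2 ^ (N + 1) * ((∏ j, ((2 : ℝ≥0∞) ^ (-1 / (N : ℝ))) ^ m j) *
        ∑ j, levelMass (A j) (u + m j)) := by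
  have hN0 : (N : ℝ) ≠ 0 := by positivity
  have hα : 0 ≤ ((N : ℝ) + 1) / (2 * N) := by positivity
  have hfin : ∀ j, {y | A j y ≠ 0 ∧ Int.log 2 (A j y) = u + m j}.Finite := fun j =>
    finite_log_eq ((hA j).trans_lt ENNReal.one_lt_top).ne _
  set E : ι → Finset Y := fun j => (hfin j).toFinset with hE
  have hEmem : ∀ j y, y ∈ E j ↔ A j y ≠ 0 ∧ Int.log 2 (A j y) = u + m j := by simp [hE]
  have hJ : (Finset.univ.erase i).card = N := by
    rw [Finset.card_erase_of_mem (Finset.mem_univ i), Finset.card_univ, hι]; rfl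
  have hcard : (s.card : ℝ≥0∞) ≤ ∏ j ∈ Finset.univ.erase i, ((E j).card : ℝ≥0∞) := by
    exact_mod_cast card_le_prod_erase (hπ i) E s fun x hx j => (hEmem j _).2 (hs x hx j)
  have hprod : ∀ x ∈ s, ∏ j, (A j (π j x) : ℝ≥0∞) ≤
      2 ^ (N + 1) * ∏ j, (2 : ℝ≥0∞) ^ ((u + m j : ℤ) : ℝ) := by
    intro x hx
    rw [← hι, ← Finset.card_univ, ← Finset.prod_const, ← Finset.prod_mul_distrib]
    gcongr with j
    rw [← (hs x hx j).2]
    exact le_two_rpow_log_add_one _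
  -- The dropped factor is `2 ^ u`; it is shared equally among the `N` remaining indices.
  have hu : (2 : ℝ≥0∞) ^ ((u + m i : ℤ) : ℝ) =
      ∏ _j ∈ Finset.univ.erase i, (2 : ℝ≥0∞) ^ ((u : ℝ) / N) := by
    rw [Finset.prod_const, hJ, ← ENNReal.rpow_natCast, ← ENNReal.rpow_mul, hi]
    congr 1
    push_cast
    field_simp
    ring
  have hmass : ∀ j, levelMass (A j) (u + m j) ≤ 1 := fun j =>
    (ENNReal.le_tsum (f := levelMass (A j)) _).trans ((tsum_levelMass (A j)).trans_le (hA j))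
  calc ∑ x ∈ s, W x * ∏ j, (A j (π j x) : ℝ≥0∞)
      ≤ ∑ x ∈ s, W x * (2 ^ (N + 1) * ∏ j, (2 : ℝ≥0∞) ^ ((u + m j : ℤ) : ℝ)) :=
        Finset.sum_le_sum fun x hx => mul_le_mul_right (hprod x hx) _
    _ = (∑ x ∈ s, W x) * (2 ^ (N + 1) * ∏ j, (2 : ℝ≥0∞) ^ ((u + m j : ℤ) : ℝ)) :=
        (Finset.sum_mul _ _ _).symm
    _ ≤ (C * (∏ j ∈ Finset.univ.erase i, ((E j).card : ℝ≥0∞)) ^ (((N : ℝ) + 1) / (2 * N))) *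
          (2 ^ (N + 1) * ∏ j, (2 : ℝ≥0∞) ^ ((u + m j : ℤ) : ℝ)) := by
        gcongr
        exact (hW s).trans (by gcongr)
    _ = C * 2 ^ (N + 1) * ∏ j ∈ Finset.univ.erase i, ((2 : ℝ≥0∞) ^ ((u : ℝ) / N) *
          (2 : ℝ≥0∞) ^ ((u + m j : ℤ) : ℝ) *
            ((E j).card : ℝ≥0∞) ^ (((N : ℝ) + 1) / (2 * N))) := by
        rw [← Finset.mul_prod_erase Finset.univ _ (Finset.mem_univ i), hu,
          ← ENNReal.prod_rpow_of_nonneg hα, Finset.prod_mul_distrib, Finset.prod_mul_distrib]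
        ring
    _ ≤ C * 2 ^ (N + 1) * ∏ j ∈ Finset.univ.erase i, (((2 : ℝ≥0∞) ^ (-1 / (N : ℝ))) ^ m j *
          levelMass (A j) (u + m j) ^ (((N : ℝ) + 1) / (2 * N))) := by
        refine mul_le_mul_right (Finset.prod_le_prod' fun j _ => ?_) _
        exact two_rpow_mul_rpow_le hN u (m j)
          (card_le_levelMass (A j) _ (E j) fun y hy => (hEmem j y).1 hy)
    _ ≤ _ := by
        rw [Finset.prod_mul_distrib, ← Finset.mul_prod_erase Finset.univ
          (fun j => ((2 : ℝ≥0∞) ^ (-1 / (N : ℝ))) ^ m j) (Finset.mem_univ i), hi, pow_zero, one_mul]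
        gcongr
        exact prod_rpow_le_sum hN hJ hmass

theorem tsum_form_le (hN : 1 ≤ N) (hι : Fintype.card ι = N + 1)
    (hπ : ∀ i x x', (∀ j, j ≠ i → π j x = π j x') → x = x')
    (hW : ∀ s : Finset X, ∑ x ∈ s, W x ≤ C * (s.card : ℝ≥0∞) ^ (((N : ℝ) + 1) / (2 * N)))
    {A : ι → Y → ℝ≥0} (hA : ∀ j, ∑' y, (A j y : ℝ≥0∞) ^ 2 ≤ 1) :
    ∑' x, W x * ∏ j, (A j (π j x) : ℝ≥0∞) ≤
      C * 2 ^ (N + 1) * (((1 - (2 : ℝ≥0∞) ^ (-1 / (N : ℝ)))⁻¹) ^ (N + 1) * (N + 1)) := by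
  classical
  have : Nonempty ι := Fintype.card_pos_iff.1 (by omega)
  set f : X → ℝ≥0∞ := fun x => W x * ∏ j, (A j (π j x) : ℝ≥0∞) with hf
  let L : X → ι → ℤ := fun x j => Int.log 2 (A j (π j x))
  let u : X → ℤ := fun x => Finset.univ.inf' Finset.univ_nonempty (L x)
  have huL : ∀ x j, u x ≤ L x j := fun x j => Finset.inf'_le _ (Finset.mem_univ j)
  -- A block is coded by its smallest level and the excesses above it; `toNat` loses nothing because
  -- `u x ≤ L x j`.
  let c : X → (ι → ℕ) × ℤ := fun x => (fun j => (L x j - u x).toNat, u x)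
  have hblock : ∀ b : (ι → ℕ) × ℤ, ∑' x : c ⁻¹' {b}, f x ≤ C * 2 ^ (N + 1) *
      ((∏ j, ((2 : ℝ≥0∞) ^ (-1 / (N : ℝ))) ^ b.1 j) *
        ∑ j, levelMass (A j) (b.2 + b.1 j)) := by
    rintro ⟨m, v⟩
    rw [ENNReal.tsum_eq_iSup_sum]
    refine iSup_le fun t => ?_
    -- Points where some factor vanishes contribute nothing, and their logarithm is only a default
    -- value.
    set s : Finset X := (t.map (Function.Embedding.subtype _)).filter
      fun x => ∀ j, A j (π j x) ≠ 0 with hs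
    have hsum : ∑ x ∈ t, f x = ∑ x ∈ s, f x := by
      rw [hs, Finset.sum_filter_of_ne, Finset.sum_map]
      · rfl
      · intro x _ hx j hj
        exact hx (by simp only [hf]; rw [Finset.prod_eq_zero (Finset.mem_univ j) (by simp [hj])]; simp)
    rw [hsum]
    have hmem : ∀ x ∈ s, c x = (m, v) ∧ ∀ j, A j (π j x) ≠ 0 := by
      intro x hx
      rw [hs, Finset.mem_filter, Finset.mem_map] at hx
      obtain ⟨⟨y, -, rfl⟩, hx⟩ := hx
      exact ⟨y.2, hx⟩
    have hlog : ∀ x ∈ s, ∀ j, L x j = v + m j := by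
      intro x hx j
      obtain ⟨h, -⟩ := hmem x hx
      have h1 : (L x j - u x).toNat = m j := congrFun (congrArg Prod.fst h) j
      have h2 : u x = v := congrArg Prod.snd h
      have := huL x j
      omega
    rcases s.eq_empty_or_nonempty with h0 | ⟨x₀, hx₀⟩
    · simp [h0]
    -- Levels are constant on the block, so the index minimising at `x₀` serves every point of `s`.
    obtain ⟨i, -, hi⟩ := Finset.exists_mem_eq_inf' Finset.univ_nonempty (L x₀)
    have hi' : m i = 0 := by
      have h2 : u x₀ = v := congrArg Prod.snd (hmem x₀ hx₀).1
      have h3 := hlog x₀ hx₀ i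
      have h4 : u x₀ = L x₀ i := hi
      omega
    exact sum_block_le hN hι hπ hW hA v m hi' s fun x hx j => ⟨(hmem x hx).2 j, hlog x hx j⟩
  have hmass : ∀ m : ι → ℕ, ∑' v : ℤ, ∑ j, levelMass (A j) (v + m j) ≤ N + 1 := by
    intro m
    rw [Summable.tsum_finsetSum fun _ _ => ENNReal.summable]
    calc ∑ j, ∑' v : ℤ, levelMass (A j) (v + m j) ≤ ∑ _j : ι, (1 : ℝ≥0∞) := by
          refine Finset.sum_le_sum fun j _ => ?_
          refine ((Equiv.addRight (m j : ℤ)).tsum_eq (levelMass (A j))).trans_le ?_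
          exact (tsum_levelMass (A j)).trans_le (hA j)
      _ = N + 1 := by simp [hι]
  rw [← ENNReal.tsum_fiberwise f c]
  refine (ENNReal.tsum_le_tsum hblock).trans ?_
  rw [ENNReal.tsum_mul_left, ENNReal.tsum_prod']
  simp only [ENNReal.tsum_mul_left]
  gcongr
  refine (ENNReal.tsum_le_tsum fun m => mul_le_mul_right (hmass m) _).trans ?_
  rw [ENNReal.tsum_mul_right]
  gcongr
  simpa [hι] using ENNReal.tsum_prod_geometric_le (ι := ι) ((2 : ℝ≥0∞) ^ (-1 / (N : ℝ)))

end Form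

/-! ### Homogeneity and membership in the class -/

theorem ellTwoNorm_sq {K : Type*} (A : K → ℝ≥0) :
    ellTwoNorm A ^ 2 = ∑' k, (A k : ℝ≥0∞) ^ 2 := by
  rw [ellTwoNorm, ← ENNReal.rpow_natCast, ← ENNReal.rpow_mul]
  norm_num

theorem eq_zero_of_ellTwoNorm_eq_zero {K : Type*} {A : K → ℝ≥0} (h : ellTwoNorm A = 0) (k : K) :
    A k = 0 := by
  have := ellTwoNorm_sq A
  rw [h, zero_pow two_ne_zero, eq_comm, ENNReal.tsum_eq_zero] at this
  simpa using this k

/-- Homogeneity: a bound for normalised families gives the bound for all families. -/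
theorem tsum_form_le_mul_prod {ι X Y : Type*} [Fintype ι] {π : ι → X → Y}
    {W : X → ℝ≥0∞} {D : ℝ≥0∞} (hD : D ≠ 0)
    (h : ∀ A : ι → Y → ℝ≥0, (∀ j, ∑' y, (A j y : ℝ≥0∞) ^ 2 ≤ 1) →
      ∑' x, W x * ∏ j, (A j (π j x) : ℝ≥0∞) ≤ D) (A : ι → Y → ℝ≥0) :
    ∑' x, W x * ∏ j, (A j (π j x) : ℝ≥0∞) ≤ D * ∏ j, ellTwoNorm (A j) := by
  classical
  by_cases h0 : ∃ j, ellTwoNorm (A j) = 0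
  · obtain ⟨j, hj⟩ := h0
    have : ∀ x, W x * ∏ j, (A j (π j x) : ℝ≥0∞) = 0 := fun x => by
      rw [Finset.prod_eq_zero (Finset.mem_univ j)
        (by simp [eq_zero_of_ellTwoNorm_eq_zero hj]), mul_zero]
    simp [this]
  push Not at h0
  by_cases htop : ∃ j, ellTwoNorm (A j) = ∞
  · obtain ⟨j, hj⟩ := htop
    have : ∏ j, ellTwoNorm (A j) = ∞ := by
      rw [← Finset.mul_prod_erase _ _ (Finset.mem_univ j), hj,
        ENNReal.top_mul (Finset.prod_ne_zero_iff.2 fun k _ => h0 k)]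
    rw [this, ENNReal.mul_top hD]
    exact le_top
  push Not at htop
  set a : ι → ℝ≥0 := fun j => (ellTwoNorm (A j)).toNNReal with ha
  have haA : ∀ j, (a j : ℝ≥0∞) = ellTwoNorm (A j) := fun j => ENNReal.coe_toNNReal (htop j)
  have ha0 : ∀ j, a j ≠ 0 := fun j hj => h0 j (by rw [← haA, hj, ENNReal.coe_zero])
  have key := h (fun j y => (a j)⁻¹ * A j y) fun j => by
    push_cast [ENNReal.coe_inv (ha0 j)]
    simp only [mul_pow]
    rw [ENNReal.tsum_mul_left, ← ellTwoNorm_sq, haA, ← mul_pow,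
      ENNReal.inv_mul_cancel (h0 j) (htop j), one_pow]
  calc ∑' x, W x * ∏ j, (A j (π j x) : ℝ≥0∞)
      = ∑' x, (∏ j, ellTwoNorm (A j)) *
          (W x * ∏ j, (((a j)⁻¹ * A j (π j x) : ℝ≥0) : ℝ≥0∞)) := by
        refine tsum_congr fun x => ?_
        rw [mul_left_comm, ← Finset.prod_mul_distrib]
        congr 1
        refine Finset.prod_congr rfl fun j _ => ?_
        rw [← haA, ← ENNReal.coe_mul, mul_inv_cancel_left₀ (ha0 j)]
    _ = (∏ j, ellTwoNorm (A j)) *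
          ∑' x, W x * ∏ j, (((a j)⁻¹ * A j (π j x) : ℝ≥0) : ℝ≥0∞) := ENNReal.tsum_mul_left
    _ ≤ (∏ j, ellTwoNorm (A j)) * D := mul_le_mul_right key _
    _ = _ := mul_comm _ _

theorem mul_card_rpow_le_weakEllNorm {X : Type*} {V : X → ℝ} {q : ℝ} (hq : 0 ≤ q)
    (hV : MemWeakEll q V) {t : ℝ} (ht : 0 < t) (s : Finset X) (hs : ∀ x ∈ s, t < V x) :
    t * (s.card : ℝ) ^ (1 / q) ≤ (weakEllNorm q V).toReal := by
  rw [← ENNReal.ofReal_le_iff_le_toReal hV.ne]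
  lift t to ℝ≥0 using ht.le
  refine le_trans ?_ (le_iSup₂ (f := fun (t : ℝ≥0) (_ : 0 < t) => (t : ℝ≥0∞) *
    (({k : X | (t : ℝ) < ‖V k‖}.encard : ℕ∞) : ℝ≥0∞) ^ (1 / q)) t (by exact_mod_cast ht))
  have hq' : 0 ≤ 1 / q := by positivity
  rw [ENNReal.ofReal_mul ht.le, ENNReal.ofReal_coe_nnreal,
    ← ENNReal.ofReal_rpow_of_nonneg (by positivity) hq', ENNReal.ofReal_natCast]
  gcongr
  have : ((s : Set X).encard : ℕ∞) ≤ {k : X | (t : ℝ) < ‖V k‖}.encard :=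
    Set.encard_le_encard fun x hx => (hs x hx).trans_le (Real.le_norm_self _)
  rw [Set.encard_coe_eq_coe_finsetCard] at this
  exact_mod_cast this

/-- The sum map together with the coordinate projections. -/
def sumOrCoord (N : ℕ) (G : Type*) [AddCommMonoid G] : Fin (N + 1) → (Fin N → G) → G :=
  Fin.cons (fun ν => ∑ j, ν j) fun j ν => ν j

/-- A missing coordinate is the sum minus the other coordinates. -/
theorem eq_of_sumOrCoord_eq {N : ℕ} {G : Type*} [AddCommGroup G] (i : Fin (N + 1))
    (x x' : Fin N → G) (h : ∀ j, j ≠ i → sumOrCoord N G j x = sumOrCoord N G j x') : x = x' := by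
  have hcoord : ∀ j : Fin N, j.succ ≠ i → x j = x' j := fun j hj => by
    simpa [sumOrCoord] using h j.succ hj
  funext k
  by_cases hk : k.succ = i
  · have h0 : ∑ j, x j = ∑ j, x' j := by
      simpa [sumOrCoord] using h 0 (by rw [← hk]; exact (Fin.succ_ne_zero k).symm)
    rw [← Finset.add_sum_erase _ _ (Finset.mem_univ k),
      ← Finset.add_sum_erase _ x' (Finset.mem_univ k)] at h0
    rw [Finset.sum_congr rfl fun j hj => hcoord j fun hji =>
      (Finset.ne_of_mem_erase hj) (Fin.succ_injective _ (hji.trans hk.symm))] at h0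
    exact add_right_cancel h0
  · exact hcoord k hk

theorem mem_classB_of_memWeakEll {n N : ℕ} (hN : 2 ≤ N) {V : (Fin N → Fin n → ℤ) → ℝ}
    (hV0 : ∀ ν, 0 ≤ V ν) (hV : MemWeakEll (2 * (N : ℝ) / ((N : ℝ) - 1)) V) : V ∈ classB n N := by
  have hN2 : (2 : ℝ) ≤ N := by exact_mod_cast hN
  have hN1 : (0 : ℝ) < N - 1 := by linarith
  set q : ℝ := 2 * (N : ℝ) / ((N : ℝ) - 1) with hq
  have hq0 : 0 < q := by positivity
  have hp : 1 / q = (N - 1) / (2 * N) := by rw [hq, one_div_div]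
  have hp1 : 1 / q < 1 := by rw [hp, div_lt_one (by positivity)]; linarith
  have hα : 1 - 1 / q = ((N : ℝ) + 1) / (2 * N) := by rw [hp]; field_simp; ring
  set M := (weakEllNorm q V).toReal
  have hW : ∀ s : Finset (Fin N → Fin n → ℤ), ∑ x ∈ s, ENNReal.ofReal (V x) ≤
      ENNReal.ofReal (M / (1 - 1 / q)) * (s.card : ℝ≥0∞) ^ (((N : ℝ) + 1) / (2 * N)) := by
    intro s
    have := sum_le_of_level_card_le (by positivity) hp1 ENNReal.toReal_nonneg
      (fun t ht s hs => mul_card_rpow_le_weakEllNorm hq0.le hV ht s hs) s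
    rw [← ENNReal.ofReal_sum_of_nonneg fun x _ => hV0 x, ← hα, ← ENNReal.ofReal_natCast,
      ENNReal.ofReal_rpow_of_nonneg (by positivity) (by linarith),
      ← ENNReal.ofReal_mul (div_nonneg ENNReal.toReal_nonneg (by linarith))]
    exact ENNReal.ofReal_le_ofReal this
  set D : ℝ≥0∞ := ENNReal.ofReal (M / (1 - 1 / q)) * 2 ^ (N + 1) *
    (((1 - (2 : ℝ≥0∞) ^ (-1 / (N : ℝ)))⁻¹) ^ (N + 1) * (N + 1)) with hD
  have hDtop : D ≠ ∞ := by
    have h1 : (2 : ℝ≥0∞) ^ (-1 / (N : ℝ)) < 1 :=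
      ENNReal.rpow_lt_one_of_one_lt_of_neg (by norm_num)
        (div_neg_of_neg_of_pos (by norm_num) (by linarith))
    have h2 : (1 - (2 : ℝ≥0∞) ^ (-1 / (N : ℝ)))⁻¹ ≠ ∞ :=
      ENNReal.inv_ne_top.2 (tsub_pos_of_lt h1).ne'
    refine ENNReal.mul_ne_top (ENNReal.mul_ne_top ENNReal.ofReal_ne_top (by finiteness)) ?_
    exact ENNReal.mul_ne_top (ENNReal.pow_ne_top h2) (by finiteness)
  -- `D` vanishes when `V = 0`; adding `1` makes the constant positive and keeps its product with
  -- infinite norms infinite.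
  refine ⟨hV0, D.toNNReal + 1, by positivity, fun A => ?_⟩
  have hmain := tsum_form_le_mul_prod (π := sumOrCoord N (Fin n → ℤ))
    (W := fun x => ENNReal.ofReal (V x)) (D := D + 1) (by simp)
    (fun A hA => (tsum_form_le (by omega) (Fintype.card_fin _) eq_of_sumOrCoord_eq hW hA).trans
      le_self_add) A
  rw [ENNReal.coe_add, ENNReal.coe_toNNReal hDtop, ENNReal.coe_one]
  refine le_trans (le_of_eq (tsum_congr fun ν => ?_)) hmain
  rw [Fin.prod_univ_succ, mul_assoc]
  simp [sumOrCoord]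

/-! ### The power weight -/

theorem abs_le_latticeNorm {n : ℕ} (μ : Fin n → ℤ) (i : Fin n) : |(μ i : ℝ)| ≤ latticeNorm μ := by
  rw [latticeNorm, ← Real.sqrt_sq_eq_abs]
  exact Real.sqrt_le_sqrt (Finset.single_le_sum (f := fun i => (μ i : ℝ) ^ 2)
    (fun _ _ => sq_nonneg _) (Finset.mem_univ i))

theorem latticeNorm_nonneg {n : ℕ} (μ : Fin n → ℤ) : 0 ≤ latticeNorm μ := Real.sqrt_nonneg _

/-- The set lies in a cube of side `2⌊R⌋ + 1 ≤ 3R`, using `R ≥ 1`. -/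
theorem encard_sum_latticeNorm_lt_le {n N : ℕ} {R : ℝ} (hR : 1 ≤ R) :
    (({ν : Fin N → Fin n → ℤ | 1 + ∑ j, latticeNorm (ν j) < R}.encard : ℕ∞) : ℝ≥0∞) ≤
      ENNReal.ofReal ((3 * R) ^ (n * N)) := by
  classical
  set B : Finset (Fin N → Fin n → ℤ) := Fintype.piFinset fun _ => Fintype.piFinset fun _ =>
    Finset.Icc (-⌊R⌋) ⌊R⌋ with hB
  have hsub : {ν : Fin N → Fin n → ℤ | 1 + ∑ j, latticeNorm (ν j) < R} ⊆ B := by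
    intro ν hν
    rw [Set.mem_ofPred_eq] at hν
    simp only [hB, Finset.mem_coe, Fintype.mem_piFinset, Finset.mem_Icc, ← abs_le]
    intro j i
    rw [Int.le_floor]
    have h1 := abs_le_latticeNorm (ν j) i
    have h2 := Finset.single_le_sum (f := fun j => latticeNorm (ν j))
      (fun j _ => latticeNorm_nonneg _) (Finset.mem_univ j)
    push_cast
    linarith
  have hcard : (B.card : ℝ) ≤ (3 * R) ^ (n * N) := by
    have hfl : (0 : ℤ) ≤ ⌊R⌋ := Int.floor_nonneg.2 (by linarith)
    have hIcc : ((Finset.Icc (-⌊R⌋) ⌊R⌋).card : ℝ) ≤ 3 * R := by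
      rw [Int.card_Icc]
      have : ((⌊R⌋ + 1 - -⌊R⌋).toNat : ℝ) = 2 * ⌊R⌋ + 1 := by
        rw [← Int.cast_natCast, Int.toNat_of_nonneg (by omega)]
        push_cast
        ring
      rw [this]
      linarith [Int.floor_le R]
    simp only [hB, Fintype.card_piFinset, Finset.prod_const, Finset.card_univ, Fintype.card_fin]
    push_cast
    rw [← pow_mul]
    gcongr
  calc _ ≤ (((B : Set (Fin N → Fin n → ℤ)).encard : ℕ∞) : ℝ≥0∞) := by
        exact_mod_cast Set.encard_le_encard hsub
    _ = ENNReal.ofReal B.card := by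
        rw [Set.encard_coe_eq_coe_finsetCard, ENNReal.ofReal_natCast]; rfl
    _ ≤ _ := ENNReal.ofReal_le_ofReal hcard

/-- The weight exceeds `t` only where `1 + ∑ |ν_j| < R = t ^ (-1/e)`. Since `nN/q = e`, the count
`(3R) ^ (nN)` to the power `1/q` is `3 ^ e / t`. -/
theorem memWeakEll_one_add_sum_latticeNorm {n N : ℕ} (hN : 2 ≤ N) :
    MemWeakEll (2 * (N : ℝ) / ((N : ℝ) - 1)) (fun ν : Fin N → Fin n → ℤ =>
      (1 + ∑ j, latticeNorm (ν j)) ^ (-(((N : ℝ) - 1) * (n : ℝ) / 2))) := by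
  have hN2 : (2 : ℝ) ≤ N := by exact_mod_cast hN
  have hN1 : (0 : ℝ) < N - 1 := by linarith
  have hp : 1 / (2 * (N : ℝ) / ((N : ℝ) - 1)) = (N - 1) / (2 * N) := by rw [one_div_div]
  have hp0 : 0 ≤ ((N : ℝ) - 1) / (2 * N) := by positivity
  have hbase : ∀ ν : Fin N → Fin n → ℤ, 1 ≤ 1 + ∑ j, latticeNorm (ν j) := fun ν =>
    le_add_of_nonneg_right (Finset.sum_nonneg fun j _ => latticeNorm_nonneg _)
  set e : ℝ := ((N : ℝ) - 1) * (n : ℝ) / 2 with he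
  have he0 : 0 ≤ e := by positivity
  refine (iSup₂_le fun t ht => ?_ : _ ≤ ENNReal.ofReal (3 ^ e)).trans_lt ENNReal.ofReal_lt_top
  rw [hp]
  have hnorm : ∀ ν : Fin N → Fin n → ℤ, ‖(1 + ∑ j, latticeNorm (ν j)) ^ (-e)‖ =
      (1 + ∑ j, latticeNorm (ν j)) ^ (-e) := fun ν =>
    Real.norm_of_nonneg (Real.rpow_nonneg (by linarith [hbase ν]) _)
  simp only [hnorm]
  have ht' : (0 : ℝ) < t := by exact_mod_cast ht
  by_cases ht1 : (1 : ℝ) ≤ t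
  · have : {ν : Fin N → Fin n → ℤ | (t : ℝ) < (1 + ∑ j, latticeNorm (ν j)) ^ (-e)} = ∅ := by
      refine Set.eq_empty_of_forall_notMem fun ν hν => ?_
      exact absurd (ht1.trans_lt hν)
        (Real.rpow_le_one_of_one_le_of_nonpos (hbase ν) (by linarith)).not_gt
    rw [this, Set.encard_empty]
    simp only [ENat.toENNReal_zero]
    rw [ENNReal.zero_rpow_of_pos (by positivity), mul_zero]
    exact zero_le
  push Not at ht1
  -- For `n = 0` the exponent `e` is `0` and `R` is not available, but the lattice is a single
  -- point.
  rcases Nat.eq_zero_or_pos n with rfl | hn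
  · have h1 : (({ν : Fin N → Fin 0 → ℤ | (t : ℝ) <
        (1 + ∑ j, latticeNorm (ν j)) ^ (-e)}.encard : ℕ∞) : ℝ≥0∞) ≤ 1 := by
      have := Set.encard_le_one_iff_subsingleton.2 (Set.subsingleton_of_subsingleton
        (s := {ν : Fin N → Fin 0 → ℤ | (t : ℝ) < (1 + ∑ j, latticeNorm (ν j)) ^ (-e)}))
      exact_mod_cast this
    calc _ ≤ (1 : ℝ≥0∞) * 1 ^ (((N : ℝ) - 1) / (2 * N)) := by
          gcongr
          exact_mod_cast ht1.le
      _ = 1 := by simp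
      _ ≤ _ := by simp [he]
  have hn' : (0 : ℝ) < n := by exact_mod_cast hn
  have he' : 0 < e := by positivity
  set R : ℝ := (t : ℝ) ^ (-e⁻¹) with hR
  have hR1 : 1 ≤ R := Real.one_le_rpow_of_pos_of_le_one_of_nonpos ht' ht1.le
    (by simpa using he'.le)
  have hRe : R ^ e = (t : ℝ)⁻¹ := by
    rw [hR, ← Real.rpow_mul ht'.le, neg_mul, inv_mul_cancel₀ he'.ne', Real.rpow_neg_one]
  have hset : {ν : Fin N → Fin n → ℤ | (t : ℝ) < (1 + ∑ j, latticeNorm (ν j)) ^ (-e)} ⊆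
      {ν | 1 + ∑ j, latticeNorm (ν j) < R} := by
    intro ν hν
    simp only [Set.mem_ofPred_eq] at hν ⊢
    have hb := hbase ν
    rw [← Real.rpow_lt_rpow_iff (by linarith) (by linarith) he', hRe]
    rw [Real.rpow_neg (by linarith)] at hν
    exact (lt_inv_comm₀ ht' (by positivity)).1 hν
  calc _ ≤ (t : ℝ≥0∞) * (ENNReal.ofReal ((3 * R) ^ (n * N))) ^ (((N : ℝ) - 1) / (2 * N)) := by
        gcongr
        exact le_trans (by exact_mod_cast Set.encard_le_encard hset)
          (encard_sum_latticeNorm_lt_le hR1)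
    _ = ENNReal.ofReal (t * ((3 * R) ^ (n * N)) ^ (((N : ℝ) - 1) / (2 * N))) := by
        rw [ENNReal.ofReal_mul ht'.le, ENNReal.ofReal_coe_nnreal,
          ENNReal.ofReal_rpow_of_nonneg (by positivity) hp0]
    _ = ENNReal.ofReal (3 ^ e) := by
        congr 1
        rw [← Real.rpow_natCast, ← Real.rpow_mul (by positivity)]
        have : ((n * N : ℕ) : ℝ) * (((N : ℝ) - 1) / (2 * N)) = e := by
          rw [he]; push_cast; field_simp
        rw [this, Real.mul_rpow (by norm_num) (by positivity), hRe]
        field_simp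

theorem proposition3p3 (n N : ℕ) (hN : 2 ≤ N) :
    (∀ V : (Fin N → Fin n → ℤ) → ℝ, (∀ ν, 0 ≤ V ν) →
      MemWeakEll (2 * (N : ℝ) / ((N : ℝ) - 1)) V → V ∈ classB n N) ∧
    (fun ν : Fin N → Fin n → ℤ =>
      (1 + ∑ j, latticeNorm (ν j)) ^ (-(((N : ℝ) - 1) * (n : ℝ) / 2))) ∈ classB n N := by
  refine ⟨fun V hV0 hV => mem_classB_of_memWeakEll hN hV0 hV,
    mem_classB_of_memWeakEll hN (fun ν => ?_) (memWeakEll_one_add_sum_latticeNorm hN)⟩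
  exact Real.rpow_nonneg
    (add_nonneg zero_le_one (Finset.sum_nonneg fun j _ => latticeNorm_nonneg _)) _
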